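/- Let $\mathcal H_A=\mathbb C^{A}$ and $\mathcal H_B=\mathbb C^{B}$ be finite-dimensional complex Hilbert spaces (operators being written as matrices in fixed orthonormal bases), and let $\mathcal H_{AB}=\mathcal H_A\otimes\mathcal H_B$. A state is a positive semidefinite operator of trace one; it is faithful if it is positive definite. All logarithms are to base $2$. For a state $\rho_{AB}$ on $\mathcal H_{AB}$ put $\rho_B=\operatorname{tr}_A\rho_{AB}$, let $S(\rho)=-\operatorname{tr}(\rho\log\rho)$ be the von Neumann entropy (with $0\log 0=0$), and let $S(A|B)_\rho=S(\rho_{AB})-S(\rho_B)$ be the conditional entropy. For a state $\sigma$ and a faithful state $\rho$ let $D(\sigma\|\rho)=\operatorname{tr}\big(\sigma(\log\sigma-\log\rho)\big)$. For a self-adjoint operator $L$ let $\lambda_+(L)$ and $\lambda_-(L)$ be its largest and smallest eigenvalue, and let $\|L\|_1=\operatorname{tr}|L|$. For a state $\sigma$ let $$B_\varepsilon(\sigma)=\{\omega \text{ a state}:\tfrac12\|\omega-\sigma\|_1\le\varepsilon\},\qquad B_\varepsilon^+(\sigma)=\{\omega\in B_\varepsilon(\sigma):\omega\text{ is faithful}\}.$$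 **Corollary 3.6.** Let $\sigma_{AB}$ be a faithful state on $\mathcal H_{AB}$, let $\varepsilon\in(0,1]$ and let $\rho_{AB}\in B_\varepsilon^+(\sigma_{AB})$. Then $\rho_{AB}$ has maximum conditional entropy in the ball, i.e. $S(A|B)_\omega\le S(A|B)_\rho$ for all $\omega_{AB}\in B_\varepsilon(\sigma_{AB})$, if and only if $$S(A|B)_\rho-S(A|B)_\sigma-D(\sigma_{AB}\|\rho_{AB})+D(\sigma_B\|\rho_B)=\varepsilon\big(\lambda_+(L_\rho)-\lambda_-(L_\rho)\big),$$ where $L_\rho=\mathbb 1_A\otimes\log\rho_B-\log\rho_{AB}$. -/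

import Mathlib

noncomputable section

namespace QuantumInfo

open scoped Kronecker ComplexOrder

section SingleSystem

variable {n : Type*} [Fintype n]

/-- The set of quantum states (density matrices): positive semidefinite matrices of trace one. -/
def states (n : Type*) [Fintype n] : Set (Matrix n n ℂ) :=
  {ρ | ρ.PosSemidef ∧ ρ.trace = 1}

/-- The set of faithful states: positive definite matrices of trace one. -/
def faithfulStates (n : Type*) [Fintype n] : Set (Matrix n n ℂ) :=
  {ρ | ρ.PosDef ∧ ρ.trace = 1}

variable [DecidableEq n]

/-- The base-2 logarithm of a Hermitian matrix, by functional calculus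
(with the convention that the eigenvalue 0 is sent to 0). -/
def log2 (M : Matrix n n ℂ) : Matrix n n ℂ :=
  cfc (Real.logb 2) M

/-- The trace norm `tr |M|` of a Hermitian matrix `M`. -/
def traceNorm (M : Matrix n n ℂ) : ℝ :=
  (cfc (fun x : ℝ => |x|) M).trace.re

/-- The closed `ε`-ball of states around `σ`, in trace distance. -/
def ball (ε : ℝ) (σ : Matrix n n ℂ) : Set (Matrix n n ℂ) :=
  {ω | ω ∈ states n ∧ (1 / 2 : ℝ) * traceNorm (ω - σ) ≤ ε}

/-- The faithful states in the `ε`-ball around `σ`. -/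
def ballPos (ε : ℝ) (σ : Matrix n n ℂ) : Set (Matrix n n ℂ) :=
  ball ε σ ∩ faithfulStates n

/-- The von Neumann entropy `S(ρ) = - tr (ρ log₂ ρ)`. -/
def entropy (ρ : Matrix n n ℂ) : ℝ :=
  -(ρ * log2 ρ).trace.re

/-- The quantum relative entropy `D(ρ‖σ) = tr (ρ (log₂ ρ - log₂ σ))`, for a state `ρ` and a
faithful state `σ` (so that the value is finite). -/
def relEntropy (ρ σ : Matrix n n ℂ) : ℝ :=
  (ρ * (log2 ρ - log2 σ)).trace.re

/-- The largest eigenvalue of a Hermitian matrix. -/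
def maxEigenvalue (M : Matrix n n ℂ) : ℝ :=
  sSup (spectrum ℝ M)

/-- The smallest eigenvalue of a Hermitian matrix. -/
def minEigenvalue (M : Matrix n n ℂ) : ℝ :=
  sInf (spectrum ℝ M)

end SingleSystem

section Bipartite

variable {A B : Type*} [Fintype A] [Fintype B]

/-- The partial trace over the first system: `ρ_B = tr_A ρ_AB`. -/
def traceA (ρ : Matrix (A × B) (A × B) ℂ) : Matrix B B ℂ :=
  Matrix.of fun b b' => ∑ a : A, ρ (a, b) (a, b')

variable [DecidableEq A] [DecidableEq B]

/-- The conditional entropy `S(A|B)_ρ = S(ρ_AB) - S(ρ_B)`. -/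
def condEntropy (ρ : Matrix (A × B) (A × B) ℂ) : ℝ :=
  entropy ρ - entropy (traceA ρ)

/-- `L_ρ = 𝟙_A ⊗ log₂ ρ_B - log₂ ρ_AB`. -/
def condEntropyGradient (ρ : Matrix (A × B) (A × B) ℂ) : Matrix (A × B) (A × B) ℂ :=
  (1 : Matrix A A ℂ) ⊗ₖ log2 (traceA ρ) - log2 ρ

end Bipartite

end QuantumInfo

end

open scoped Kronecker ComplexOrder

namespace QuantumInfo

open Filter Topology

/-! ### Traces and relative entropy in eigenbases -/

section Spectral

variable {n : Type*} [Fintype n] [DecidableEq n] {M ρ σ : Matrix n n ℂ}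

/-! `L_ρ` is the gradient of the concave functional `S(A|B)`. Since `tr (L_ρ ω) = S(A|B)_ω + D(ω‖ρ)
- D(ω_B‖ρ_B)`, the left side of the criterion is `tr (L_ρ (ρ - σ))`, and monotonicity of `D` gives
the tangent bound `S(A|B)_ω ≤ tr (L_ρ ω)`, with equality at `ω = ρ`.

On the ball, `tr (L (ω - σ)) ≤ ε (λ₊ - λ₋)` (`re_trace_mul_sub_le`). If `ρ` attains this bound, it
maximizes the tangent functional, hence the conditional entropy. Conversely, let `P`, `Q` project
onto eigenvectors for `λ₊`, `λ₋`. The point `σ + ε (P - Q)` need not be positive, but as `ρ` is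
faithful, a short segment from `ρ` towards it stays in the ball, and first order optimality gives
the missing inequality.

Monotonicity (`relEntropy_traceA_le`) comes from `⟨ρ, (L_σ + s R_ρ)⁻¹ ρ⟩`, where now `L_σ`, `R_ρ`
are left and right multiplication. This is a maximum over matrices `X`; restricting to `X = 1 ⊗ Y`
gives the form of the marginals. Integrating over `s` up to `T` and removing `tr ρ log T` yields `D`
as `T → ∞`. -/

theorem cfc_eq_conj_diagonal (hM : M.IsHermitian) (f : ℝ → ℝ) :
    cfc f M = (hM.eigenvectorUnitary : Matrix n n ℂ) *
      Matrix.diagonal (fun i => (f (hM.eigenvalues i) : ℂ)) *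
      star (hM.eigenvectorUnitary : Matrix n n ℂ) := by
  rw [hM.cfc_eq, Matrix.IsHermitian.cfc, Unitary.conjStarAlgAut_apply]
  rfl

theorem eq_conj_diagonal (hM : M.IsHermitian) :
    M = (hM.eigenvectorUnitary : Matrix n n ℂ) *
      Matrix.diagonal (fun i => (hM.eigenvalues i : ℂ)) *
      star (hM.eigenvectorUnitary : Matrix n n ℂ) := by
  conv_lhs => rw [hM.spectral_theorem, Unitary.conjStarAlgAut_apply]
  rfl

theorem trace_mul_cfc (hM : M.IsHermitian) (f : ℝ → ℝ) (X : Matrix n n ℂ) :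
    (X * cfc f M).trace = ∑ i, (f (hM.eigenvalues i) : ℂ) *
      (star (hM.eigenvectorUnitary : Matrix n n ℂ) * X * hM.eigenvectorUnitary) i i := by
  rw [cfc_eq_conj_diagonal hM, ← mul_assoc, Matrix.trace_mul_comm, ← mul_assoc, ← mul_assoc,
    Matrix.trace]
  refine Finset.sum_congr rfl fun i _ => ?_
  rw [Matrix.diag_apply, Matrix.mul_diagonal, mul_comm]

/-- The matrix of scalar products between the eigenvectors of `σ` and those of `ρ`. -/
noncomputable def transition (hρ : ρ.IsHermitian) (hσ : σ.IsHermitian) : Matrix n n ℂ :=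
  star (hσ.eigenvectorUnitary : Matrix n n ℂ) * hρ.eigenvectorUnitary

/-- The squared absolute values of the scalar products between the eigenvectors of `ρ` and
those of `σ`. -/
noncomputable def overlap (hρ : ρ.IsHermitian) (hσ : σ.IsHermitian) (i j : n) : ℝ :=
  Complex.normSq (transition hρ hσ j i)

theorem sum_overlap (hρ : ρ.IsHermitian) (hσ : σ.IsHermitian) (i : n) :
    ∑ j, overlap hρ hσ i j = 1 := by
  have h : star (transition hρ hσ) * transition hρ hσ = 1 := by
    have hV : _ * star (hσ.eigenvectorUnitary : Matrix n n ℂ) = 1 :=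
      Unitary.coe_mul_star_self hσ.eigenvectorUnitary
    have hU := Unitary.coe_star_mul_self hρ.eigenvectorUnitary
    rw [transition, star_mul, star_star, mul_assoc, ← mul_assoc _ (star _), hV, one_mul, hU]
  have := congrFun (congrFun h i) i
  rw [Matrix.mul_apply, Matrix.one_apply_eq] at this
  have h2 : ((∑ j, overlap hρ hσ i j : ℝ) : ℂ) = 1 := by
    rw [← this, Complex.ofReal_sum]
    refine Finset.sum_congr rfl fun j _ => ?_
    rw [overlap, Complex.normSq_eq_conj_mul_self]
    rfl
  exact_mod_cast h2

theorem trace_cfc_mul_cfc (hρ : ρ.IsHermitian) (hσ : σ.IsHermitian) (f g : ℝ → ℝ) :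
    (cfc f ρ * cfc g σ).trace.re = ∑ i, ∑ j, overlap hρ hσ i j *
      (f (hρ.eigenvalues i) * g (hσ.eigenvalues j)) := by
  have h : (cfc f ρ * cfc g σ).trace = ((∑ i, ∑ j, overlap hρ hσ i j *
      (f (hρ.eigenvalues i) * g (hσ.eigenvalues j)) : ℝ) : ℂ) := by
    rw [trace_mul_cfc hσ, cfc_eq_conj_diagonal hρ, Finset.sum_comm, Complex.ofReal_sum]
    refine Finset.sum_congr rfl fun j _ => ?_
    have : star (hσ.eigenvectorUnitary : Matrix n n ℂ) * ((hρ.eigenvectorUnitary : Matrix n n ℂ) *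
        (Matrix.diagonal fun i => (f (hρ.eigenvalues i) : ℂ)) *
          star (hρ.eigenvectorUnitary : Matrix n n ℂ)) *
          (hσ.eigenvectorUnitary : Matrix n n ℂ) =
        transition hρ hσ * (Matrix.diagonal fun i => (f (hρ.eigenvalues i) : ℂ)) *
          star (transition hρ hσ) := by
      simp only [transition, star_mul, star_star, mul_assoc]
    rw [this, Matrix.mul_apply, Finset.mul_sum, Complex.ofReal_sum]
    refine Finset.sum_congr rfl fun i _ => ?_
    rw [Matrix.mul_diagonal, overlap, Matrix.star_apply]
    push_cast
    rw [Complex.normSq_eq_conj_mul_self, ← starRingEnd_apply]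
    ring
  rw [h, Complex.ofReal_re]

theorem trace_cfc_re (hM : M.IsHermitian) (f : ℝ → ℝ) :
    (cfc f M).trace.re = ∑ i, f (hM.eigenvalues i) := by
  have := trace_mul_cfc hM f 1
  rw [one_mul] at this
  rw [this]
  simp

/-- As the overlaps sum to one over `j`, the term `tr (ρ log ρ)` spreads over the same double sum as
`tr (ρ log σ)`, which reduces later limits to scalars. -/
theorem relEntropy_eq_sum (hρ : ρ.IsHermitian) (hσ : σ.IsHermitian) :
    relEntropy ρ σ = ∑ i, ∑ j, overlap hρ hσ i j * (hρ.eigenvalues i *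
      (Real.logb 2 (hρ.eigenvalues i) - Real.logb 2 (hσ.eigenvalues j))) := by
  have h1 : (ρ * log2 ρ).trace.re =
      ∑ i, hρ.eigenvalues i * Real.logb 2 (hρ.eigenvalues i) := by
    rw [← trace_cfc_re hρ (fun x => x * Real.logb 2 x), log2, cfc_eq_conj_diagonal hρ,
      cfc_eq_conj_diagonal hρ (fun x => x * Real.logb 2 x)]
    nth_rw 1 [eq_conj_diagonal hρ]
    have hU := Unitary.coe_star_mul_self hρ.eigenvectorUnitary
    rw [mul_assoc _ (star _), ← mul_assoc (star _), ← mul_assoc (star _), hU, one_mul,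
      ← mul_assoc, mul_assoc _ (Matrix.diagonal _) (Matrix.diagonal _),
      Matrix.diagonal_mul_diagonal]
    push_cast
    rfl
  have h2 : (ρ * log2 σ).trace.re = ∑ i, ∑ j, overlap hρ hσ i j *
      (hρ.eigenvalues i * Real.logb 2 (hσ.eigenvalues j)) := by
    have := trace_cfc_mul_cfc hρ hσ id (Real.logb 2)
    rw [(cfc_eq_conj_diagonal hρ id).trans (eq_conj_diagonal hρ).symm] at this
    exact this
  rw [relEntropy, mul_sub, Matrix.trace_sub, Complex.sub_re, h1, h2, ← Finset.sum_sub_distrib]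
  refine Finset.sum_congr rfl fun i _ => ?_
  rw [← one_mul (hρ.eigenvalues i * _), ← sum_overlap hρ hσ i, Finset.sum_mul,
    ← Finset.sum_sub_distrib]
  exact Finset.sum_congr rfl fun j _ => by ring

end Spectral

/-! ### Variational formula for the resolvent form -/

section Variational

variable {n : Type*} [Fintype n] [DecidableEq n] {ρ σ : Matrix n n ℂ}

/-- The quadratic functional whose maximum over `X` is `⟨ρ, (L_σ + s R_ρ)⁻¹ ρ⟩`. -/
noncomputable def resolventFunctional (ρ σ : Matrix n n ℂ) (s : ℝ) (X : Matrix n n ℂ) : ℝ :=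
  2 * (star X * ρ).trace.re - (X * star X * σ).trace.re - s * (star X * X * ρ).trace.re

/-- Left multiplication by `σ` and right multiplication by `ρ` are diagonal in the matrix units
built from the two eigenbases, so the entries of `x` decouple. -/
theorem resolventFunctional_conj (hρ : ρ.IsHermitian) (hσ : σ.IsHermitian) (s : ℝ)
    (x : Matrix n n ℂ) :
    resolventFunctional ρ σ s ((hσ.eigenvectorUnitary : Matrix n n ℂ) * x *
        star (hρ.eigenvectorUnitary : Matrix n n ℂ)) =
      ∑ i, ∑ j, (2 * (hρ.eigenvalues i * (star (x j i) * transition hρ hσ j i).re) -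
        (hσ.eigenvalues j + s * hρ.eigenvalues i) * Complex.normSq (x j i)) := by
  set U := hρ.eigenvectorUnitary.1
  set V := hσ.eigenvectorUnitary.1
  set p := hρ.eigenvalues
  set q := hσ.eigenvalues
  have hU : star U * U = 1 := Unitary.coe_star_mul_self hρ.eigenvectorUnitary
  have hV : star V * V = 1 := Unitary.coe_star_mul_self hσ.eigenvectorUnitary
  have key (Z W : Matrix n n ℂ) (d : n → ℝ) (hW : star W * W = 1) (hZ : Z = W *
      Matrix.diagonal (fun i => (d i : ℂ)) * star W) (Y : Matrix n n ℂ) :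
      (Y * Z).trace.re = ∑ i, d i * ((star W * Y * W) i i).re := by
    rw [hZ, ← mul_assoc, Matrix.trace_mul_comm, ← mul_assoc, ← mul_assoc, Matrix.trace,
      Complex.re_sum]
    refine Finset.sum_congr rfl fun i _ => ?_
    rw [Matrix.diag_apply, Matrix.mul_diagonal, mul_comm, Complex.re_ofReal_mul]
  have e1 : star U * star (V * x * star U) * U = star x * transition hρ hσ := by
    calc _ = star U * U * star x * (star V * U) := by simp only [star_mul, star_star, mul_assoc]
      _ = _ := by rw [hU, one_mul]; rfl
  have e2 : star V * (V * x * star U * star (V * x * star U)) * V = x * star x := by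
    calc _ = (star V * V) * x * (star U * U) * star x * (star V * V) := by
          simp only [star_mul, star_star, mul_assoc]
      _ = _ := by rw [hU, hV]; simp
  have e3 : star U * (star (V * x * star U) * (V * x * star U)) * U = star x * x := by
    calc _ = (star U * U) * star x * (star V * V) * x * (star U * U) := by
          simp only [star_mul, star_star, mul_assoc]
      _ = _ := by rw [hU, hV]; simp
  rw [resolventFunctional, key ρ U p hU (eq_conj_diagonal hρ), key σ V q hV (eq_conj_diagonal hσ),
    key ρ U p hU (eq_conj_diagonal hρ), e1, e2, e3]
  have f1 : ∀ i, ((star x * transition hρ hσ) i i).re =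
      ∑ j, (star (x j i) * transition hρ hσ j i).re := fun i => by
    rw [Matrix.mul_apply, Complex.re_sum]; rfl
  have f2 : ∀ j, ((x * star x) j j).re = ∑ i, Complex.normSq (x j i) := fun j => by
    rw [Matrix.mul_apply, Complex.re_sum]
    refine Finset.sum_congr rfl fun i _ => ?_
    rw [Matrix.star_apply, ← starRingEnd_apply, Complex.mul_conj, Complex.ofReal_re]
  have f3 : ∀ i, ((star x * x) i i).re = ∑ j, Complex.normSq (x j i) := fun i => by
    rw [Matrix.mul_apply, Complex.re_sum]
    refine Finset.sum_congr rfl fun j _ => ?_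
    rw [Matrix.star_apply, mul_comm, ← starRingEnd_apply, Complex.mul_conj, Complex.ofReal_re]
  simp only [f1, f2, f3, Finset.mul_sum]
  rw [Finset.sum_comm (f := fun j i => q j * Complex.normSq (x j i)), ← Finset.sum_sub_distrib,
    ← Finset.sum_sub_distrib]
  refine Finset.sum_congr rfl fun i _ => ?_
  rw [← Finset.sum_sub_distrib, ← Finset.sum_sub_distrib]
  exact Finset.sum_congr rfl fun j _ => by ring

/-- The spectral expression for `⟨ρ, (L_σ + s R_ρ)⁻¹ ρ⟩`. -/
noncomputable def resolventForm (hρ : ρ.IsHermitian) (hσ : σ.IsHermitian) (s : ℝ) : ℝ :=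
  ∑ i, ∑ j, overlap hρ hσ i j *
    (hρ.eigenvalues i * (hρ.eigenvalues i / (hσ.eigenvalues j + s * hρ.eigenvalues i)))

theorem resolventFunctional_le (hρ : ρ.PosSemidef) (hσ : σ.PosDef) {s : ℝ} (hs : 0 ≤ s)
    (X : Matrix n n ℂ) :
    resolventFunctional ρ σ s X ≤ resolventForm hρ.1 hσ.1 s := by
  obtain ⟨x, rfl⟩ : ∃ x, X = (hσ.1.eigenvectorUnitary : Matrix n n ℂ) * x *
      star (hρ.1.eigenvectorUnitary : Matrix n n ℂ) := by
    refine ⟨star (hσ.1.eigenvectorUnitary : Matrix n n ℂ) * X * hρ.1.eigenvectorUnitary, ?_⟩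
    have hU : _ * star (hρ.1.eigenvectorUnitary : Matrix n n ℂ) = 1 :=
      Unitary.coe_mul_star_self hρ.1.eigenvectorUnitary
    have hV : _ * star (hσ.1.eigenvectorUnitary : Matrix n n ℂ) = 1 :=
      Unitary.coe_mul_star_self hσ.1.eigenvectorUnitary
    rw [mul_assoc, mul_assoc, hU, mul_one, ← mul_assoc, hV, one_mul]
  rw [resolventFunctional_conj, resolventForm]
  refine Finset.sum_le_sum fun i _ => Finset.sum_le_sum fun j _ => ?_
  have hp := hρ.eigenvalues_nonneg i
  have hq := hσ.eigenvalues_pos j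
  generalize hρ.1.eigenvalues i = p at *
  generalize hσ.1.eigenvalues j = q at *
  have hD : 0 < q + s * p := by positivity
  rw [overlap]
  generalize transition hρ.1 hσ.1 j i = w
  generalize x j i = z
  -- Completing the square in `z`.
  have : Complex.normSq w * (p * (p / (q + s * p))) -
      (2 * (p * (star z * w).re) - (q + s * p) * Complex.normSq z) =
      Complex.normSq ((p : ℂ) * w - (q + s * p : ℝ) * z) / (q + s * p) := by
    rw [eq_div_iff hD.ne']
    generalize hDe : q + s * p = D at *
    simp only [Complex.normSq_apply, Complex.mul_re, Complex.star_def, Complex.conj_re,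
      Complex.conj_im, Complex.sub_re, Complex.sub_im, Complex.mul_im, Complex.ofReal_re,
      Complex.ofReal_im]
    field_simp
    ring
  have h2 := div_nonneg (Complex.normSq_nonneg ((p : ℂ) * w - (q + s * p : ℝ) * z)) hD.le
  linarith

theorem exists_resolventFunctional_eq (hρ : ρ.PosSemidef) (hσ : σ.PosDef) {s : ℝ} (hs : 0 ≤ s) :
    ∃ X, resolventFunctional ρ σ s X = resolventForm hρ.1 hσ.1 s := by
  -- Each entry `z = p w / (q + s p)` is the zero of the square completed in
  -- `resolventFunctional_le`.
  refine ⟨(hσ.1.eigenvectorUnitary : Matrix n n ℂ) * (Matrix.of fun j i =>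
    ((hρ.1.eigenvalues i / (hσ.1.eigenvalues j + s * hρ.1.eigenvalues i) : ℝ) : ℂ) *
      transition hρ.1 hσ.1 j i) * star (hρ.1.eigenvectorUnitary : Matrix n n ℂ), ?_⟩
  rw [resolventFunctional_conj, resolventForm]
  refine Finset.sum_congr rfl fun i _ => Finset.sum_congr rfl fun j _ => ?_
  have hp := hρ.eigenvalues_nonneg i
  have hq := hσ.eigenvalues_pos j
  rw [Matrix.of_apply, overlap]
  generalize hρ.1.eigenvalues i = p at *
  generalize hσ.1.eigenvalues j = q at *
  have hD : 0 < q + s * p := by positivity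
  generalize transition hρ.1 hσ.1 j i = w
  generalize hDe : q + s * p = D at *
  simp only [Complex.normSq_apply, Complex.mul_re, Complex.star_def, Complex.conj_re,
      Complex.conj_im, Complex.mul_im, Complex.ofReal_re, Complex.ofReal_im]
  field_simp
  ring

end Variational

/-! ### Partial trace and monotonicity of the resolvent form -/

section PartialTrace

variable {A B : Type*} [Fintype A]
  {ρ σ : Matrix (A × B) (A × B) ℂ}

theorem traceA_eq_sum (ρ : Matrix (A × B) (A × B) ℂ) :
    traceA ρ = ∑ a, ρ.submatrix (Prod.mk a) (Prod.mk a) := by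
  ext b b'
  simp [traceA, Matrix.sum_apply]

theorem posSemidef_traceA [Fintype B] (hρ : ρ.PosSemidef) : (traceA ρ).PosSemidef := by
  rw [traceA_eq_sum]
  exact Matrix.posSemidef_sum _ fun a _ => hρ.submatrix _

theorem posDef_traceA [Fintype B] [Nonempty A] (hρ : ρ.PosDef) : (traceA ρ).PosDef := by
  rw [traceA_eq_sum]
  exact Matrix.posDef_sum Finset.univ_nonempty fun a _ =>
    hρ.submatrix (Prod.mk_right_injective a)

theorem trace_traceA [Fintype B] (ρ : Matrix (A × B) (A × B) ℂ) : (traceA ρ).trace = ρ.trace := by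
  simp only [Matrix.trace, Matrix.diag_apply, traceA, Matrix.of_apply]
  rw [Fintype.sum_prod_type, Finset.sum_comm]

theorem trace_one_kronecker_mul [Fintype B] [DecidableEq A] (Y : Matrix B B ℂ)
    (ρ : Matrix (A × B) (A × B) ℂ) :
    (((1 : Matrix A A ℂ) ⊗ₖ Y) * ρ).trace = (Y * traceA ρ).trace := by
  have h (a : A) (b : B) : (((1 : Matrix A A ℂ) ⊗ₖ Y) * ρ) (a, b) (a, b) =
      ∑ c, Y b c * ρ (a, c) (a, b) := by
    rw [Matrix.mul_apply, Fintype.sum_prod_type, Finset.sum_eq_single a]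
    · simp
    · intro a' _ ha
      simp [Matrix.one_apply_ne ha.symm]
    · simp
  simp only [Matrix.trace, Matrix.diag_apply, Fintype.sum_prod_type, h]
  rw [Finset.sum_comm]
  refine Finset.sum_congr rfl fun b _ => ?_
  rw [Finset.sum_comm, Matrix.mul_apply]
  refine Finset.sum_congr rfl fun c _ => ?_
  rw [traceA, Matrix.of_apply, Finset.mul_sum]

/-- `Y ↦ 1 ⊗ Y` is a star homomorphism and the trace adjoint of `traceA`. -/
theorem resolventFunctional_one_kronecker [Fintype B] [DecidableEq A] [DecidableEq B] (s : ℝ)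
    (Y : Matrix B B ℂ) :
    resolventFunctional ρ σ s ((1 : Matrix A A ℂ) ⊗ₖ Y) =
      resolventFunctional (traceA ρ) (traceA σ) s Y := by
  have h : star ((1 : Matrix A A ℂ) ⊗ₖ Y) = (1 : Matrix A A ℂ) ⊗ₖ star Y := by
    simp only [Matrix.star_eq_conjTranspose, Matrix.conjTranspose_kronecker,
      Matrix.conjTranspose_one]
  simp only [resolventFunctional, h, ← Matrix.mul_kronecker_mul, one_mul, trace_one_kronecker_mul]

theorem resolventForm_traceA_le [Fintype B] [DecidableEq A] [DecidableEq B] [Nonempty A]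
    (hρ : ρ.PosSemidef) (hσ : σ.PosDef)
    {s : ℝ} (hs : 0 ≤ s) :
    resolventForm (posSemidef_traceA hρ).1 (posDef_traceA hσ).1 s ≤ resolventForm hρ.1 hσ.1 s := by
  obtain ⟨Y, hY⟩ := exists_resolventFunctional_eq (posSemidef_traceA hρ) (posDef_traceA hσ) hs
  rw [← hY, ← resolventFunctional_one_kronecker]
  exact resolventFunctional_le hρ hσ hs _

end PartialTrace

/-! ### From resolvents to relative entropy -/

section Integrated

variable {n : Type*} [Fintype n] [DecidableEq n] {ρ σ : Matrix n n ℂ}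

/-- The spectral expression for the integral of `resolventForm` over `[0, T]`. -/
noncomputable def integratedResolventForm (hρ : ρ.IsHermitian) (hσ : σ.IsHermitian) (T : ℝ) : ℝ :=
  ∑ i, ∑ j, overlap hρ hσ i j * (hρ.eigenvalues i *
    (Real.log (hσ.eigenvalues j + T * hρ.eigenvalues i) - Real.log (hσ.eigenvalues j)))

theorem integratedResolventForm_zero (hρ : ρ.IsHermitian) (hσ : σ.IsHermitian) :
    integratedResolventForm hρ hσ 0 = 0 := by
  simp [integratedResolventForm]

theorem hasDerivAt_integratedResolventForm (hρ : ρ.PosSemidef) (hσ : σ.PosDef) {T : ℝ}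
    (hT : 0 ≤ T) :
    HasDerivAt (integratedResolventForm hρ.1 hσ.1) (resolventForm hρ.1 hσ.1 T) T := by
  unfold integratedResolventForm resolventForm
  refine HasDerivAt.fun_sum fun i _ => HasDerivAt.fun_sum fun j _ => ?_
  have hp := hρ.eigenvalues_nonneg i
  have hq := hσ.eigenvalues_pos j
  have hD : hσ.1.eigenvalues j + T * hρ.1.eigenvalues i ≠ 0 := by positivity
  have h1 : HasDerivAt (fun t => hσ.1.eigenvalues j + t * hρ.1.eigenvalues i)
      (hρ.1.eigenvalues i) T := by
    simpa using ((hasDerivAt_id T).mul_const (hρ.1.eigenvalues i)).const_add (hσ.1.eigenvalues j)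
  exact (((h1.log hD).sub_const _).const_mul _).const_mul _

theorem tendsto_integratedResolventForm (hρ : ρ.PosSemidef) (hσ : σ.PosDef) :
    Tendsto (fun T => integratedResolventForm hρ.1 hσ.1 T - ρ.trace.re * Real.log T) atTop
      (𝓝 (Real.log 2 * relEntropy ρ σ)) := by
  have h2 : Real.log 2 ≠ 0 := (Real.log_pos one_lt_two).ne'
  have e1 (T : ℝ) : integratedResolventForm hρ.1 hσ.1 T - ρ.trace.re * Real.log T =
      ∑ i, ∑ j, overlap hρ.1 hσ.1 i j * (hρ.1.eigenvalues i *
        (Real.log (hσ.1.eigenvalues j + T * hρ.1.eigenvalues i) - Real.log T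
          - Real.log (hσ.1.eigenvalues j))) := by
    have ht : ρ.trace.re = ∑ i, hρ.1.eigenvalues i := by
      rw [hρ.1.trace_eq_sum_eigenvalues, Complex.re_sum]
      rfl
    rw [integratedResolventForm, ht, Finset.sum_mul, ← Finset.sum_sub_distrib]
    refine Finset.sum_congr rfl fun i _ => ?_
    rw [← one_mul (hρ.1.eigenvalues i * Real.log T), ← sum_overlap hρ.1 hσ.1 i, Finset.sum_mul,
      ← Finset.sum_sub_distrib]
    exact Finset.sum_congr rfl fun j _ => by ring
  simp only [e1]
  rw [relEntropy_eq_sum hρ.1 hσ.1, Finset.mul_sum]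
  refine tendsto_finsetSum _ fun i _ => ?_
  rw [Finset.mul_sum]
  refine tendsto_finsetSum _ fun j _ => ?_
  have hp := hρ.eigenvalues_nonneg i
  have hq := hσ.eigenvalues_pos j
  generalize hρ.1.eigenvalues i = p at *
  generalize hσ.1.eigenvalues j = q at *
  have e2 : Real.log 2 * (overlap hρ.1 hσ.1 i j * (p * (Real.logb 2 p - Real.logb 2 q))) =
      overlap hρ.1 hσ.1 i j * (p * (Real.log p - Real.log q)) := by
    simp only [Real.logb]
    field_simp
  rw [e2]
  refine Tendsto.const_mul _ ?_
  -- For `p = 0` the outer factor annihilates the term; otherwise `log (q / T + p)` tends to `log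
  -- p`.
  rcases hp.eq_or_lt with rfl | hp
  · simp
  refine Tendsto.const_mul _ (Tendsto.sub_const ?_ _)
  have h3 : Tendsto (fun T : ℝ => q * T⁻¹ + p) atTop (𝓝 p) := by
    simpa using (tendsto_inv_atTop_zero.const_mul q).add_const p
  refine (h3.log hp.ne').congr' ?_
  filter_upwards [eventually_gt_atTop 0] with T hT
  rw [← Real.log_div (by positivity) hT.ne']
  congr 1
  field_simp

end Integrated

/-- Monotonicity of the relative entropy under the partial trace. -/
theorem relEntropy_traceA_le {A B : Type*} [Fintype A] [DecidableEq A] [Fintype B] [DecidableEq B]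
    [Nonempty A] {ρ σ : Matrix (A × B) (A × B) ℂ} (hρ : ρ.PosSemidef) (hσ : σ.PosDef) :
    relEntropy (traceA ρ) (traceA σ) ≤ relEntropy ρ σ := by
  have hρB := posSemidef_traceA hρ
  have hσB := posDef_traceA hσ
  have hd (T : ℝ) (hT : 0 ≤ T) : HasDerivAt (fun T => integratedResolventForm hρ.1 hσ.1 T -
      integratedResolventForm hρB.1 hσB.1 T)
      (resolventForm hρ.1 hσ.1 T - resolventForm hρB.1 hσB.1 T) T :=
    (hasDerivAt_integratedResolventForm hρ hσ hT).sub
      (hasDerivAt_integratedResolventForm hρB hσB hT)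
  have hm : MonotoneOn (fun T => integratedResolventForm hρ.1 hσ.1 T -
      integratedResolventForm hρB.1 hσB.1 T) (Set.Ici 0) := by
    refine monotoneOn_of_deriv_nonneg (convex_Ici 0)
      (fun T hT => (hd T hT).continuousAt.continuousWithinAt)
      (fun T hT => (hd T ?_).differentiableAt.differentiableWithinAt) fun T hT => ?_
    · exact interior_subset hT
    · rw [(hd T (interior_subset hT)).deriv]
      exact sub_nonneg.2 (resolventForm_traceA_le hρ hσ (interior_subset hT))
  -- The divergent terms `tr ρ log T` agree on both sides because `traceA` preserves the trace.
  have hlim : Real.log 2 * relEntropy (traceA ρ) (traceA σ) ≤ Real.log 2 * relEntropy ρ σ := by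
    refine le_of_tendsto_of_tendsto (tendsto_integratedResolventForm hρB hσB)
      (tendsto_integratedResolventForm hρ hσ) ?_
    filter_upwards [eventually_ge_atTop 0] with T hT
    have := hm Set.self_mem_Ici hT hT
    simp only [integratedResolventForm_zero, sub_zero] at this
    rw [trace_traceA]
    linarith
  exact le_of_mul_le_mul_left hlim (Real.log_pos one_lt_two)

/-! ### The tangent bound for the conditional entropy -/

section CondEntropy

variable {A B : Type*} [Fintype A] [DecidableEq A] [Fintype B] [DecidableEq B]
  {ρ ω : Matrix (A × B) (A × B) ℂ}

theorem trace_condEntropyGradient_mul (ρ ω : Matrix (A × B) (A × B) ℂ) :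
    (condEntropyGradient ρ * ω).trace.re =
      (log2 (traceA ρ) * traceA ω).trace.re - (log2 ρ * ω).trace.re := by
  rw [condEntropyGradient, sub_mul, Matrix.trace_sub, Complex.sub_re, trace_one_kronecker_mul]

theorem trace_condEntropyGradient_mul_self (ρ : Matrix (A × B) (A × B) ℂ) :
    (condEntropyGradient ρ * ρ).trace.re = condEntropy ρ := by
  rw [trace_condEntropyGradient_mul, condEntropy, entropy, entropy, Matrix.trace_mul_comm,
    Matrix.trace_mul_comm (log2 ρ)]
  ring

theorem trace_condEntropyGradient_mul_eq (ρ ω : Matrix (A × B) (A × B) ℂ) :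
    (condEntropyGradient ρ * ω).trace.re =
      condEntropy ω + relEntropy ω ρ - relEntropy (traceA ω) (traceA ρ) := by
  rw [trace_condEntropyGradient_mul, condEntropy, entropy, entropy, Matrix.trace_mul_comm,
    Matrix.trace_mul_comm (log2 ρ), relEntropy, relEntropy]
  simp only [mul_sub, Matrix.trace_sub, Complex.sub_re]
  ring

/-- The conditional entropy lies below its tangent at a faithful state. -/
theorem condEntropy_le_trace_condEntropyGradient_mul [Nonempty A] (hω : ω.PosSemidef)
    (hρ : ρ.PosDef) : condEntropy ω ≤ (condEntropyGradient ρ * ω).trace.re := by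
  have := relEntropy_traceA_le hω hρ
  rw [trace_condEntropyGradient_mul_eq]
  linarith

end CondEntropy

/-! ### Trace norm, extreme eigenvalues and linear functionals on the ball -/

theorem re_diag_conj_nonneg {n : Type*} [Fintype n] {X : Matrix n n ℂ} (hX : X.PosSemidef)
    (U : Matrix n n ℂ) (i : n) :
    0 ≤ ((star U * X * U) i i).re :=
  (Complex.nonneg_iff.1 (hX.conjTranspose_mul_mul_same U).diag_nonneg).1

section TraceNorm

variable {n : Type*} [Fintype n] [DecidableEq n] {M P Q L : Matrix n n ℂ}

theorem posSemidef_cfc (hM : M.IsHermitian) {f : ℝ → ℝ} (hf : ∀ x, 0 ≤ f x) :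
    (cfc f M).PosSemidef := by
  rw [cfc_eq_conj_diagonal hM, Matrix.star_eq_conjTranspose]
  refine Matrix.PosSemidef.mul_mul_conjTranspose_same (Matrix.PosSemidef.diagonal fun i => ?_) _
  simpa using hf (hM.eigenvalues i)

theorem isHermitian_cfc (f : ℝ → ℝ) (M : Matrix n n ℂ) : (cfc f M).IsHermitian :=
  cfc_predicate f M

theorem re_trace_eq_sum (hM : M.IsHermitian) (X : Matrix n n ℂ) :
    X.trace.re = ∑ i, ((star hM.eigenvectorUnitary.1 * X * hM.eigenvectorUnitary.1) i i).re := by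
  have hU : _ * star hM.eigenvectorUnitary.1 = 1 :=
    Unitary.coe_mul_star_self hM.eigenvectorUnitary
  rw [← Complex.re_sum]
  change _ = (star hM.eigenvectorUnitary.1 * X * hM.eigenvectorUnitary.1).trace.re
  rw [Matrix.trace_mul_comm, ← mul_assoc, hU, one_mul]

theorem re_trace_mul_eq_sum (hM : M.IsHermitian) (X : Matrix n n ℂ) :
    (M * X).trace.re = ∑ i, hM.eigenvalues i *
      ((star hM.eigenvectorUnitary.1 * X * hM.eigenvectorUnitary.1) i i).re := by
  have h := congrArg Complex.re (trace_mul_cfc hM id X)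
  rw [(cfc_eq_conj_diagonal hM id).trans (eq_conj_diagonal hM).symm, Matrix.trace_mul_comm,
    Complex.re_sum] at h
  rw [h]
  exact Finset.sum_congr rfl fun i _ => Complex.re_ofReal_mul _ _

theorem exists_posSemidef_sub_eq (hM : M.IsHermitian) :
    ∃ P Q : Matrix n n ℂ, P.PosSemidef ∧ Q.PosSemidef ∧ M = P - Q ∧
      P.trace.re + Q.trace.re = traceNorm M := by
  refine ⟨cfc (fun x : ℝ => max x 0) M, cfc (fun x : ℝ => max (-x) 0) M,
    posSemidef_cfc hM fun _ => le_max_right _ _, posSemidef_cfc hM fun _ => le_max_right _ _,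
    ?_, ?_⟩
  · rw [cfc_eq_conj_diagonal hM, cfc_eq_conj_diagonal hM, ← sub_mul, ← mul_sub,
      Matrix.diagonal_sub]
    conv_lhs => rw [eq_conj_diagonal hM]
    congr 3
    ext i
    rw [← Complex.ofReal_sub]
    congr 1
    rcases le_total 0 (hM.eigenvalues i) with h | h <;> simp [h]
  · rw [traceNorm, trace_cfc_re hM, trace_cfc_re hM, trace_cfc_re hM, ← Finset.sum_add_distrib]
    refine Finset.sum_congr rfl fun i _ => ?_
    rcases le_total 0 (hM.eigenvalues i) with h | h <;> simp [h, abs_of_nonneg, abs_of_nonpos]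

/-- In an eigenbasis of `P - Q` each eigenvalue is a difference of nonnegative diagonal entries.
This replaces the triangle inequality. -/
theorem traceNorm_sub_le (hP : P.PosSemidef) (hQ : Q.PosSemidef) :
    traceNorm (P - Q) ≤ P.trace.re + Q.trace.re := by
  have hM : (P - Q).IsHermitian := hP.1.sub hQ.1
  rw [traceNorm, trace_cfc_re hM]
  rw [re_trace_eq_sum hM P, re_trace_eq_sum hM Q, ← Finset.sum_add_distrib]
  have hU' : star hM.eigenvectorUnitary.1 * hM.eigenvectorUnitary.1 = 1 :=
    Unitary.coe_star_mul_self hM.eigenvectorUnitary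
  have hD := eq_conj_diagonal hM
  set U := hM.eigenvectorUnitary.1
  refine Finset.sum_le_sum fun i _ => ?_
  have hl : hM.eigenvalues i = ((star U * P * U) i i).re - ((star U * Q * U) i i).re := by
    rw [← Complex.sub_re, ← Matrix.sub_apply, ← sub_mul, ← mul_sub]
    have : star U * (P - Q) * U = Matrix.diagonal (fun i => (hM.eigenvalues i : ℂ)) := by
      calc _ = star U * (U * Matrix.diagonal (fun i => (hM.eigenvalues i : ℂ)) * star U) * U :=
            congrArg (star U * · * U) hD
        _ = (star U * U) * Matrix.diagonal (fun i => (hM.eigenvalues i : ℂ)) * (star U * U) := by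
            simp only [mul_assoc]
        _ = _ := by rw [hU', one_mul, mul_one]
    rw [this, Matrix.diagonal_apply_eq, Complex.ofReal_re]
  rw [hl, abs_le]
  constructor <;> linarith [re_diag_conj_nonneg hP U i, re_diag_conj_nonneg hQ U i]

theorem eigenvalues_le_maxEigenvalue (hL : L.IsHermitian) (i : n) :
    hL.eigenvalues i ≤ maxEigenvalue L :=
  le_csSup L.finite_real_spectrum.bddAbove (hL.eigenvalues_mem_spectrum_real i)

theorem minEigenvalue_le_eigenvalues (hL : L.IsHermitian) (i : n) :
    minEigenvalue L ≤ hL.eigenvalues i :=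
  csInf_le L.finite_real_spectrum.bddBelow (hL.eigenvalues_mem_spectrum_real i)

theorem exists_eigenvalues_eq_maxEigenvalue [Nonempty n] (hL : L.IsHermitian) :
    ∃ i, hL.eigenvalues i = maxEigenvalue L := by
  have h : maxEigenvalue L ∈ spectrum ℝ L :=
    (Set.nonempty_of_mem (hL.eigenvalues_mem_spectrum_real (Classical.arbitrary n))).csSup_mem
      L.finite_real_spectrum
  rwa [hL.spectrum_real_eq_range_eigenvalues] at h

theorem exists_eigenvalues_eq_minEigenvalue [Nonempty n] (hL : L.IsHermitian) :
    ∃ i, hL.eigenvalues i = minEigenvalue L := by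
  have h : minEigenvalue L ∈ spectrum ℝ L :=
    (Set.nonempty_of_mem (hL.eigenvalues_mem_spectrum_real (Classical.arbitrary n))).csInf_mem
      L.finite_real_spectrum
  rwa [hL.spectrum_real_eq_range_eigenvalues] at h

theorem re_trace_mul_le (hL : L.IsHermitian) (hP : P.PosSemidef) :
    (L * P).trace.re ≤ maxEigenvalue L * P.trace.re := by
  rw [re_trace_mul_eq_sum hL, re_trace_eq_sum hL P, Finset.mul_sum]
  exact Finset.sum_le_sum fun i _ => mul_le_mul_of_nonneg_right
    (eigenvalues_le_maxEigenvalue hL i) (re_diag_conj_nonneg hP _ i)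

theorem le_re_trace_mul (hL : L.IsHermitian) (hP : P.PosSemidef) :
    minEigenvalue L * P.trace.re ≤ (L * P).trace.re := by
  rw [re_trace_mul_eq_sum hL, re_trace_eq_sum hL P, Finset.mul_sum]
  exact Finset.sum_le_sum fun i _ => mul_le_mul_of_nonneg_right
    (minEigenvalue_le_eigenvalues hL i) (re_diag_conj_nonneg hP _ i)

/-- The witness is the projection onto the `i`-th eigenvector. -/
theorem exists_posSemidef_trace_eq_one (hL : L.IsHermitian) (i : n) :
    ∃ P : Matrix n n ℂ, P.PosSemidef ∧ P.trace = 1 ∧ (L * P).trace.re = hL.eigenvalues i := by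
  have hU : star hL.eigenvectorUnitary.1 * hL.eigenvectorUnitary.1 = 1 :=
    Unitary.coe_star_mul_self hL.eigenvectorUnitary
  refine ⟨hL.eigenvectorUnitary.1 * Matrix.diagonal (Pi.single i 1) *
    star hL.eigenvectorUnitary.1, ?_, ?_, ?_⟩
  · rw [Matrix.star_eq_conjTranspose]
    refine Matrix.PosSemidef.mul_mul_conjTranspose_same (Matrix.PosSemidef.diagonal ?_) _
    exact Pi.single_nonneg.2 zero_le_one
  · rw [Matrix.trace_mul_comm, ← mul_assoc, hU, one_mul]
    simp
  · rw [re_trace_mul_eq_sum hL]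
    set U := hL.eigenvectorUnitary.1
    have : star U * (U * Matrix.diagonal (Pi.single i 1) * star U) * U =
        Matrix.diagonal (Pi.single i 1) := by
      calc _ = (star U * U) * Matrix.diagonal (Pi.single i 1) * (star U * U) := by
            simp only [mul_assoc]
        _ = _ := by rw [hU, one_mul, mul_one]
    rw [this, Finset.sum_eq_single i]
    · simp
    · intro j _ hj
      simp [hj]
    · simp

/-- The positive and negative parts of `ω - σ` have equal traces, at most `ε`; `L` pairs with the
former by at most `λ₊` and with the latter by at least `λ₋` per unit of trace. -/
theorem re_trace_mul_sub_le (hL : L.IsHermitian) {ω σ : Matrix n n ℂ} {ε : ℝ}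
    (hω : ω ∈ ball ε σ) (hσ : σ ∈ states n) :
    (L * (ω - σ)).trace.re ≤ ε * (maxEigenvalue L - minEigenvalue L) := by
  obtain ⟨P, Q, hP, hQ, hPQ, ht⟩ := exists_posSemidef_sub_eq (hω.1.1.1.sub hσ.1.1)
  have h0 : P.trace.re - Q.trace.re = 0 := by
    rw [← Complex.sub_re, ← Matrix.trace_sub, ← hPQ, Matrix.trace_sub, hω.1.2, hσ.2]
    simp
  have h1 := re_trace_mul_le hL hP
  have h2 := le_re_trace_mul hL hQ
  have h3 := hω.2
  have h4 : P.trace.re ≤ ε := by linarith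
  rw [hPQ, mul_sub, Matrix.trace_sub, Complex.sub_re]
  have h5 : 0 ≤ maxEigenvalue L - minEigenvalue L := by
    rcases isEmpty_or_nonempty n with h | ⟨⟨i⟩⟩
    · have := hσ.2
      simp [Matrix.trace] at this
    · linarith [eigenvalues_le_maxEigenvalue hL i, minEigenvalue_le_eigenvalues hL i]
  have h6 := mul_le_mul_of_nonneg_right h4 h5
  have h7 : Q.trace.re = P.trace.re := by linarith
  rw [h7] at h2
  nlinarith

end TraceNorm

/-! ### Small perturbations of a faithful state -/

section Perturbation

variable {n : Type*} [Fintype n] [DecidableEq n] {ρ H : Matrix n n ℂ}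

open scoped Matrix.Norms.L2Operator MatrixOrder in
theorem eventually_posDef_add_smul (hρ : ρ.PosDef) (hH : H.IsHermitian) :
    ∀ᶠ t : ℝ in 𝓝[>] 0, (ρ + t • H).PosDef := by
  rcases isEmpty_or_nonempty n with h | h
  · exact Eventually.of_forall fun t => Subsingleton.elim 1 (ρ + t • H) ▸ Matrix.PosDef.one
  obtain ⟨r, hr, hrρ⟩ := (CFC.exists_pos_algebraMap_le_iff hρ.1.isSelfAdjoint).2
    fun x hx => hρ.isStrictlyPositive.spectrum_pos hx
  have hn : -algebraMap ℝ (Matrix n n ℂ) ‖H‖ ≤ H :=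
    IsSelfAdjoint.neg_algebraMap_norm_le_self hH.isSelfAdjoint
  have hlim : Tendsto (fun t : ℝ => r - t * ‖H‖) (𝓝[>] 0) (𝓝 r) := by
    have : Tendsto (fun t : ℝ => r - t * ‖H‖) (𝓝 0) (𝓝 (r - 0 * ‖H‖)) :=
      (Continuous.tendsto (by fun_prop) 0)
    rw [zero_mul, sub_zero] at this
    exact this.mono_left nhdsWithin_le_nhds
  filter_upwards [hlim.eventually_const_lt hr, self_mem_nhdsWithin] with t ht ht0
  -- Combines the operator bounds `ρ ≥ r` and `H ≥ -‖H‖`.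
  have e : ρ + t • H = (r - t * ‖H‖) • (1 : Matrix n n ℂ) +
      ((ρ - algebraMap ℝ _ r) + t • (H - -algebraMap ℝ _ ‖H‖)) := by
    simp only [Algebra.algebraMap_eq_smul_one]
    module
  rw [e]
  refine (Matrix.PosDef.one.smul ht).add_posSemidef
    ((Matrix.le_iff.1 hrρ).add ((Matrix.le_iff.1 hn).smul (le_of_lt ht0)))

open scoped Matrix.Norms.L2Operator in
theorem tendsto_re_trace_log2_mul (hρ : ρ.PosDef) (hH : H.IsHermitian) (K : Matrix n n ℂ) :
    Tendsto (fun t : ℝ => (log2 (ρ + t • H) * K).trace.re) (𝓝[>] 0)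
      (𝓝 (log2 ρ * K).trace.re) := by
  -- Invertibility keeps the spectrum away from `0`, where the logarithm is discontinuous.
  have hc : ContinuousOn (fun M : Matrix n n ℂ => log2 M) {M | IsSelfAdjoint M ∧ IsUnit M} :=
    continuousOn_id.cfc_of_mem_nhdsSet _ (s := {0}ᶜ) (by
      simpa using fun _ _ ↦ spectrum.zero_notMem ℝ) (fun _ h => h.1)
      (Real.continuousOn_log.div_const _)
  have h1 : Tendsto (fun t : ℝ => ρ + t • H) (𝓝[>] 0)
      (𝓝[{M | IsSelfAdjoint M ∧ IsUnit M}] ρ) := by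
    refine tendsto_nhdsWithin_iff.2 ⟨?_, ?_⟩
    · have : Tendsto (fun t : ℝ => ρ + t • H) (𝓝 0) (𝓝 (ρ + (0 : ℝ) • H)) :=
        Continuous.tendsto (by fun_prop) 0
      rw [zero_smul, add_zero] at this
      exact this.mono_left nhdsWithin_le_nhds
    · filter_upwards [eventually_posDef_add_smul hρ hH] with t ht
      exact ⟨ht.1, ht.isUnit⟩
  have h2 : Continuous fun M : Matrix n n ℂ => (M * K).trace.re :=
    Complex.continuous_re.comp ((continuous_id.mul continuous_const).matrix_trace)
  exact (h2.tendsto _).comp ((hc ρ ⟨hρ.1, hρ.isUnit⟩).tendsto.comp h1)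

end Perturbation

/-! ### First order optimality -/

section Bipartite

variable {A B : Type*} [Fintype A] {ρ H : Matrix (A × B) (A × B) ℂ}

theorem traceA_add_smul (ρ H : Matrix (A × B) (A × B) ℂ) (t : ℝ) :
    traceA (ρ + t • H) = traceA ρ + t • traceA H := by
  ext b b'
  simp [traceA, Finset.sum_add_distrib, Finset.mul_sum]

theorem isHermitian_traceA (hH : H.IsHermitian) : (traceA H).IsHermitian := by
  ext b b'
  simp [traceA, Matrix.conjTranspose_apply, hH.apply]

variable [DecidableEq A] [Fintype B] [DecidableEq B]

theorem isHermitian_condEntropyGradient (ρ : Matrix (A × B) (A × B) ℂ) :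
    (condEntropyGradient ρ).IsHermitian := by
  refine Matrix.IsHermitian.sub ?_ (isHermitian_cfc _ _)
  rw [Matrix.IsHermitian, Matrix.conjTranspose_kronecker, Matrix.conjTranspose_one,
    log2,
    (isHermitian_cfc (Real.logb 2) (traceA ρ)).eq]

theorem tendsto_re_trace_condEntropyGradient_mul [Nonempty A] (hρ : ρ.PosDef)
    (hH : H.IsHermitian) :
    Tendsto (fun t : ℝ => (condEntropyGradient (ρ + t • H) * H).trace.re) (𝓝[>] 0)
      (𝓝 (condEntropyGradient ρ * H).trace.re) := by
  simp only [trace_condEntropyGradient_mul, traceA_add_smul]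
  exact (tendsto_re_trace_log2_mul (posDef_traceA hρ) (isHermitian_traceA hH) _).sub
    (tendsto_re_trace_log2_mul hρ hH _)

/-- First order optimality condition for a maximum of the conditional entropy at a faithful
state. -/
theorem re_trace_condEntropyGradient_mul_nonpos [Nonempty A] {S : Set (Matrix (A × B) (A × B) ℂ)}
    (hmax : IsMaxOn condEntropy S ρ) (hρ : ρ.PosDef) (hH : H.IsHermitian)
    (hS : ∀ᶠ t : ℝ in 𝓝[>] 0, ρ + t • H ∈ S) :
    (condEntropyGradient ρ * H).trace.re ≤ 0 := by
  refine le_of_tendsto (tendsto_re_trace_condEntropyGradient_mul hρ hH) ?_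
  filter_upwards [hS, eventually_posDef_add_smul hρ hH, self_mem_nhdsWithin] with t htS htP ht
  -- The tangent is taken at `ρ + t H` and evaluated at `ρ`, so the entropy is never differentiated:
  -- only continuity of the gradient is needed as `t → 0`.
  have h1 := condEntropy_le_trace_condEntropyGradient_mul hρ.posSemidef htP
  have h2 : condEntropy (ρ + t • H) ≤ condEntropy ρ := hmax htS
  rw [← trace_condEntropyGradient_mul_self (ρ + t • H), mul_add, Matrix.trace_add,
    Complex.add_re, Matrix.mul_smul, Matrix.trace_smul, Complex.real_smul,
    Complex.re_ofReal_mul] at h2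
  exact nonpos_of_mul_nonpos_right (by linarith) ht

end Bipartite

/-- At a faithful state of the ball, every direction towards a trace one perturbation of the
center of trace norm at most `2 * ε` stays in the ball for a short time. -/
theorem eventually_add_smul_mem_ball {n : Type*} [Fintype n] [DecidableEq n]
    {ρ σ P Q : Matrix n n ℂ} {ε : ℝ} (hε : 0 ≤ ε) (hσ : σ ∈ states n) (hρ : ρ ∈ ballPos ε σ)
    (hP : P.PosSemidef) (hQ : Q.PosSemidef) (hP1 : P.trace = 1) (hQ1 : Q.trace = 1) :
    ∀ᶠ t : ℝ in 𝓝[>] 0, ρ + t • (σ + ε • (P - Q) - ρ) ∈ ball ε σ := by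
  obtain ⟨R, S, hR, hS, hRS, ht⟩ := exists_posSemidef_sub_eq (hρ.2.1.1.sub hσ.1.1)
  have hH : (σ + ε • (P - Q) - ρ).IsHermitian :=
    (hσ.1.1.add ((hP.1.sub hQ.1).smul (IsSelfAdjoint.all ε))).sub hρ.2.1.1
  filter_upwards [eventually_posDef_add_smul hρ.2.1 hH, self_mem_nhdsWithin,
    nhdsWithin_le_nhds (Iio_mem_nhds one_pos)] with t htP ht0 ht1
  have ht0' : 0 ≤ t := le_of_lt ht0
  have ht1' : 0 ≤ 1 - t := sub_nonneg.2 (le_of_lt ht1)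
  refine ⟨⟨htP.posSemidef, ?_⟩, ?_⟩
  · simp [Matrix.trace_add, Matrix.trace_sub, Matrix.trace_smul, hρ.2.2, hσ.2, hP1, hQ1]
  -- Each of the two positive terms carries `t ε` from `P` or `Q`; `R` and `S` together have trace
  -- at most `2 ε`.
  · have e : ρ + t • (σ + ε • (P - Q) - ρ) - σ =
        ((1 - t) • R + (t * ε) • P) - ((1 - t) • S + (t * ε) • Q) := by
      have : ρ = σ + (R - S) := by rw [← hRS]; abel
      rw [this]
      module
    have hle := traceNorm_sub_le ((hR.smul ht1').add (hP.smul (mul_nonneg ht0' hε)))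
      ((hS.smul ht1').add (hQ.smul (mul_nonneg ht0' hε)))
    rw [← e] at hle
    simp only [Matrix.trace_add, Matrix.trace_smul, hP1, hQ1, Complex.add_re, Complex.smul_re,
      Complex.one_re, smul_eq_mul] at hle
    have h1 := mul_le_mul_of_nonneg_left hρ.1.2 ht1'
    nlinarith

end QuantumInfo

theorem corollary3p6 {A B : Type*} [Fintype A] [DecidableEq A] [Fintype B] [DecidableEq B]
    (σ : Matrix (A × B) (A × B) ℂ) (hσ : σ ∈ QuantumInfo.faithfulStates (A × B))
    (ε : ℝ) (hε : ε ∈ Set.Ioc (0 : ℝ) 1)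
    (ρ : Matrix (A × B) (A × B) ℂ) (hρ : ρ ∈ QuantumInfo.ballPos ε σ) :
    IsMaxOn QuantumInfo.condEntropy (QuantumInfo.ball ε σ) ρ ↔
      QuantumInfo.condEntropy ρ - QuantumInfo.condEntropy σ
          - QuantumInfo.relEntropy σ ρ
          + QuantumInfo.relEntropy (QuantumInfo.traceA σ) (QuantumInfo.traceA ρ)
        = ε * (QuantumInfo.maxEigenvalue (QuantumInfo.condEntropyGradient ρ)
            - QuantumInfo.minEigenvalue (QuantumInfo.condEntropyGradient ρ)) := by
  open QuantumInfo in
  have hne : Nonempty (A × B) := by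
    by_contra h
    rw [not_nonempty_iff] at h
    have := hσ.2
    simp [Matrix.trace] at this
  have hA : Nonempty A := hne.map Prod.fst
  have hσ' : σ ∈ states (A × B) := ⟨hσ.1.posSemidef, hσ.2⟩
  have hL := isHermitian_condEntropyGradient ρ
  have hlhs : condEntropy ρ - condEntropy σ - relEntropy σ ρ + relEntropy (traceA σ) (traceA ρ) =
      (condEntropyGradient ρ * (ρ - σ)).trace.re := by
    rw [mul_sub, Matrix.trace_sub, Complex.sub_re, trace_condEntropyGradient_mul_self,
      trace_condEntropyGradient_mul_eq ρ σ]
    ring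
  rw [hlhs]
  constructor
  · intro hmax
    refine le_antisymm (re_trace_mul_sub_le hL hρ.1 hσ') ?_
    obtain ⟨i, hi⟩ := exists_eigenvalues_eq_maxEigenvalue hL
    obtain ⟨j, hj⟩ := exists_eigenvalues_eq_minEigenvalue hL
    obtain ⟨P, hP, hP1, hPi⟩ := exists_posSemidef_trace_eq_one hL i
    obtain ⟨Q, hQ, hQ1, hQj⟩ := exists_posSemidef_trace_eq_one hL j
    have h := re_trace_condEntropyGradient_mul_nonpos hmax hρ.2.1
      ((hσ.1.1.add ((hP.1.sub hQ.1).smul (IsSelfAdjoint.all ε))).sub hρ.2.1.1)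
      (eventually_add_smul_mem_ball hε.1.le hσ' hρ hP hQ hP1 hQ1)
    simp only [mul_sub, mul_add, Matrix.mul_smul, Matrix.trace_sub, Matrix.trace_add,
      Matrix.trace_smul, Complex.sub_re, Complex.add_re, Complex.smul_re, smul_eq_mul, hPi, hQj,
      hi, hj] at h ⊢
    linarith
  · intro heq ω hω
    -- The chain is `S(A|B)_ω ≤ tr (L_ρ ω) ≤ tr (L_ρ ρ) = S(A|B)_ρ`.
    have h1 := condEntropy_le_trace_condEntropyGradient_mul hω.1.1 hρ.2.1
    have h2 := re_trace_mul_sub_le hL hω hσ'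
    rw [← heq] at h2
    simp only [mul_sub, Matrix.trace_sub, Complex.sub_re] at h2
    rw [Set.mem_ofPred_eq, ← trace_condEntropyGradient_mul_self ρ]
    linarith
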